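/- **Conventions.** For a set $\Omega$, $\mathrm{Sym}(\Omega)$ carries the topology whose open sets are the unions of cosets of pointwise stabilizers of finite subsets; subgroups carry the subspace topology and quotients the quotient topology. A *permutation structure* $W$ is a set $W$ with a closed subgroup $\mathrm{Aut}(W)\le \mathrm{Sym}(W)$. An $\mathrm{Aut}(W)$-*congruence* is an $\mathrm{Aut}(W)$-invariant equivalence relation on $W$. For $A\subseteq W$, $\mathrm{Aut}(W/\{A\})$ is the setwise stabilizer of $A$ in $\mathrm{Aut}(W)$. A *finite cover* $\pi:C\to W$ is a finite-to-one surjection between permutation structures whose fibres form an $\mathrm{Aut}(C)$-invariant partition and such that the induced map $\mu:\mathrm{Aut}(C)\to \mathrm{Sym}(W)$ has image $\mathrm{Aut}(W)$; its kernel is $K=\ker\mu$. For $A\subseteq W$ put $C(A)=\pi^{-1}(A)$; let $F(A)$ and $B(A)=K(A)$ be the permutation groups induced on $C(A)$ by the setwise stabilizer of $C(A)$ in $\mathrm{Aut}(C)$ and by $K$, respectively ($B(\{w\})$ is the binding group at $w$), and let $\chi_A:\mathrm{Aut}(W/\{A\})\to F(A)/B(A)$ be the map $\chi_A(g)=h|_{C(A)}B(A)$,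 where $h\in\mathrm{Aut}(C)$ is any element with $\mu(h)=g$. Two finite covers $\pi_1:C_1\to W$, $\pi_2:C_2\to W$ are *isomorphic over $W$* if there is a bijection $\alpha:C_1\to C_2$ with $\pi_2\alpha=\pi_1$ and $\alpha\,\mathrm{Aut}(C_1)\,\alpha^{-1}=\mathrm{Aut}(C_2)$. Let $\rho$ be an $\mathrm{Aut}(W)$-congruence, $[w]$ the class of $w$, and $G$ a group. A finite cover $\pi$ is *almost free with respect to $\rho$, with binding groups isomorphic to $G$*, if $B(\{w\})\cong G$ for all $w$, $K([w])\cong G$ for all $w$, and $K(\{w_1,w_2\})\cong G\times G$ whenever $w_2\notin[w_1]$. Its kernel *is the full product over the classes* if $K=\prod_{r\in W/\rho}K(r)$, that is, for every family $(k_r)_{r\in W/\rho}$ in $K$ the permutation of $C$ acting as $k_r$ on $C(r)$ for every $r$ lies in $K$. **Proposition.** Let $W$ be a transitive permutation structure and $\rho$ an $\mathrm{Aut}(W)$-congruence such that the induced map $M:\mathrm{Aut}(W)\to \mathrm{Sym}(W/\rho)$ is injective, open onto its image, and has closed image. Let $w_0\in W$. Let $F$ be a closed permutation group on a set $X$ and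 $\sigma:X\to[w_0]$ a finite-to-one surjection whose fibres form an $F$-invariant partition of $X$ and such that the image of the induced map $T:F\to \mathrm{Sym}([w_0])$ is the group induced on $[w_0]$ by $\mathrm{Aut}(W/\{[w_0]\})$. Let $B=\ker T$, let $G$ be the permutation group induced by $B$ on $\sigma^{-1}(w_0)$, and let $\chi:\mathrm{Aut}(W/\{[w_0]\})\to F/B$ be given by $\chi(g)=hB$, where $h\in F$ and $T(h)=g|_{[w_0]}$. Assume that $\chi$ is continuous and that $B\cong G$ as groups. Say that a finite cover $\pi:C\to W$ *has the data* $(F,B,\chi)$ if there is a bijection $\gamma:C([w_0])\to X$ with $\sigma\gamma=\pi|_{C([w_0])}$, $\gamma F([w_0])\gamma^{-1}=F$, $\gamma B([w_0])\gamma^{-1}=B$, and such that the induced isomorphism $F([w_0])/B([w_0])\to F/B$ carries $\chi_{[w_0]}$ to $\chi$. Then: 1. (Existence) There is a finite cover $\pi_0$ of $W$ that is almost free with respect to $\rho$, whose binding groups are all isomorphic to $G$ as permutation groups, whose kernel is the full product over the classes, and which has the data $(F,B,\chi)$. 2. (Uniqueness) Let $\pi$ be a finite cover of $W$ that is almost free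 with respect to $\rho$ with binding groups isomorphic to $G$ and that has the data $(F,B,\chi)$. If the kernel of $\pi$ is the full product over the classes, or if the group $G$ is perfect (for example non-abelian simple), then $\pi$ is isomorphic over $W$ to $\pi_0$. -/

import Mathlib

universe u v w

namespace FinCov

/-! ### Permutation groups and their topology -/

/-- The topology on the symmetric group: the open sets are the unions of cosets of pointwise
stabilizers of finite sets (the coset of `g` consists of all `h` that agree with `g` on `Γ`). -/
instance permTopology (Ω : Type u) : TopologicalSpace (Equiv.Perm Ω) where
  IsOpen U := ∀ g ∈ U, ∃ Γ : Finset Ω, ∀ h : Equiv.Perm Ω, (∀ x ∈ Γ, h x = g x) → h ∈ U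
  isOpen_univ := fun _ _ => ⟨∅, fun _ _ => Set.mem_univ _⟩
  isOpen_inter := by
    classical
    intro U V hU hV g hg
    obtain ⟨Γ, hΓ⟩ := hU g hg.1
    obtain ⟨Δ, hΔ⟩ := hV g hg.2
    exact ⟨Γ ∪ Δ, fun h hh =>
      ⟨hΓ h fun x hx => hh x (Finset.mem_union_left _ hx),
       hΔ h fun x hx => hh x (Finset.mem_union_right _ hx)⟩⟩
  isOpen_sUnion := by
    intro 𝒰 h𝒰 g hg
    obtain ⟨U, hU, hgU⟩ := hg
    obtain ⟨Γ, hΓ⟩ := h𝒰 U hU g hgU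
    exact ⟨Γ, fun h hh => ⟨U, hU, hΓ h hh⟩⟩

theorem perm_apply_inv {Ω : Type u} (g : Equiv.Perm Ω) (x : Ω) : g (g⁻¹ x) = x :=
  Equiv.apply_symm_apply g x

theorem perm_inv_apply {Ω : Type u} (g : Equiv.Perm Ω) (x : Ω) : g⁻¹ (g x) = x :=
  Equiv.symm_apply_apply g x

/-- The setwise stabilizer of `A` in the permutation group `P`. -/
def setStab {Ω : Type u} (P : Subgroup (Equiv.Perm Ω)) (A : Set Ω) :
    Subgroup (Equiv.Perm Ω) where
  carrier := {g | g ∈ P ∧ ∀ x, g x ∈ A ↔ x ∈ A}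
  one_mem' := ⟨P.one_mem, fun _ => Iff.rfl⟩
  mul_mem' := fun {a b} ha hb =>
    ⟨P.mul_mem ha.1 hb.1, fun x => (ha.2 (b x)).trans (hb.2 x)⟩
  inv_mem' := fun {a} ha => ⟨P.inv_mem ha.1, fun x => by
    have h := ha.2 (a⁻¹ x)
    rw [perm_apply_inv] at h
    exact h.symm⟩

/-- The permutation group induced by `P` on `A`: all permutations of `A` that extend to an
element of `P` (such an element necessarily stabilizes `A`). -/
def inducedOn {Ω : Type u} (P : Subgroup (Equiv.Perm Ω)) (A : Set Ω) :
    Subgroup (Equiv.Perm A) where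
  carrier := {t | ∃ g ∈ P, ∀ x : A, g x = t x}
  one_mem' := ⟨1, P.one_mem, fun _ => rfl⟩
  mul_mem' := by
    rintro s t ⟨g, hg, hgs⟩ ⟨h, hh, hht⟩
    exact ⟨g * h, P.mul_mem hg hh, fun x => by
      rw [Equiv.Perm.mul_apply, Equiv.Perm.mul_apply, hht, hgs]⟩
  inv_mem' := by
    rintro t ⟨g, hg, hgt⟩
    refine ⟨g⁻¹, P.inv_mem hg, fun x => ?_⟩
    rw [Equiv.Perm.inv_eq_iff_eq, hgt, perm_apply_inv]

/-- The fibres of `f` form a `P`-invariant partition. -/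
def FibresInvariant {C : Type v} {W : Type u} (P : Subgroup (Equiv.Perm C)) (f : C → W) : Prop :=
  ∀ g ∈ P, ∀ a b, f a = f b → f (g a) = f (g b)

section Induced

variable {C : Type v} {W : Type u} (P : Subgroup (Equiv.Perm C)) (f : C → W)
  (hf : Function.Surjective f)

/-- The map on `W` induced by an element of a group preserving the fibres of `f`:
`w ↦ f (g (f⁻¹ w))`. -/
noncomputable def inducedFun (g : P) (w : W) : W :=
  f ((g : Equiv.Perm C) (Function.surjInv hf w))

theorem inducedFun_apply (hP : FibresInvariant P f) (g : P) (c : C) :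
    inducedFun P f hf g (f c) = f ((g : Equiv.Perm C) c) :=
  hP g g.2 _ _ (Function.surjInv_eq hf (f c))

variable (hP : FibresInvariant P f)

/-- The homomorphism from `P` to the symmetric group of `W` induced by `f`. -/
noncomputable def inducedHom : P →* Equiv.Perm W where
  toFun g :=
    { toFun := inducedFun P f hf g
      invFun := inducedFun P f hf g⁻¹
      left_inv := fun w => by
        obtain ⟨c, rfl⟩ := hf w
        rw [inducedFun_apply P f hf hP, inducedFun_apply P f hf hP]
        simp
      right_inv := fun w => by
        obtain ⟨c, rfl⟩ := hf w
        rw [inducedFun_apply P f hf hP, inducedFun_apply P f hf hP]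
        simp }
  map_one' := by
    ext w
    obtain ⟨c, rfl⟩ := hf w
    exact inducedFun_apply P f hf hP 1 c
  map_mul' g h := by
    ext w
    obtain ⟨c, rfl⟩ := hf w
    change inducedFun P f hf (g * h) (f c) = inducedFun P f hf g (inducedFun P f hf h (f c))
    rw [inducedFun_apply P f hf hP, inducedFun_apply P f hf hP, inducedFun_apply P f hf hP]
    rfl

theorem inducedHom_apply (g : P) (c : C) :
    inducedHom P f hf hP g (f c) = f ((g : Equiv.Perm C) c) :=
  inducedFun_apply P f hf hP g c

/-- The kernel of the induced homomorphism, as a permutation group on `C`. -/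
noncomputable def inducedKer : Subgroup (Equiv.Perm C) :=
  (inducedHom P f hf hP).ker.map P.subtype

theorem mem_inducedKer (g : Equiv.Perm C) :
    g ∈ inducedKer P f hf hP ↔ g ∈ P ∧ ∀ c, f (g c) = f c := by
  constructor
  · rintro ⟨h, hh, rfl⟩
    refine ⟨h.2, fun c => ?_⟩
    have h1 : inducedHom P f hf hP h = 1 := hh
    have h2 := inducedHom_apply P f hf hP h c
    rw [h1] at h2
    exact h2.symm
  · rintro ⟨hg, hc⟩
    refine ⟨⟨g, hg⟩, ?_, rfl⟩
    change inducedHom P f hf hP ⟨g, hg⟩ = 1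
    ext w
    obtain ⟨c, rfl⟩ := hf w
    rw [inducedHom_apply]
    exact hc c

instance inducedKer_normal : ((inducedKer P f hf hP).subgroupOf P).Normal := by
  rw [inducedKer, Subgroup.subgroupOf,
    Subgroup.comap_map_eq_self_of_injective P.subtype_injective]
  infer_instance

end Induced

/-! ### Permutation structures, congruences, finite covers -/

/-- A permutation structure with domain `W`: a closed subgroup of `Sym(W)`, regarded as the
automorphism group of the structure. -/
structure PermStructure (W : Type u) where
  Aut : Subgroup (Equiv.Perm W)
  isClosed_Aut : IsClosed (Aut : Set (Equiv.Perm W))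

/-- The structure is transitive. -/
def PermStructure.IsTransitive {W : Type u} (S : PermStructure W) : Prop :=
  ∀ a b : W, ∃ g ∈ S.Aut, g a = b

/-- The equivalence relation `ρ` is an `Aut(W)`-congruence. -/
def PermStructure.IsCongruence {W : Type u} (S : PermStructure W) (ρ : Setoid W) : Prop :=
  ∀ g ∈ S.Aut, ∀ a b, ρ a b → ρ (g a) (g b)

/-- The `ρ`-class `[w]`. -/
def cls {W : Type u} (ρ : Setoid W) (w : W) : Set W := {x | ρ x w}

theorem PermStructure.IsCongruence.fibresInvariant {W : Type u} {S : PermStructure W}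
    {ρ : Setoid W} (h : S.IsCongruence ρ) :
    FibresInvariant S.Aut (Quotient.mk ρ) :=
  fun g hg a b hab => Quotient.sound (h g hg a b (Quotient.exact hab))

/-- The induced map `M : Aut(W) → Sym(W/ρ)`. -/
noncomputable def classHom {W : Type u} {S : PermStructure W} {ρ : Setoid W}
    (h : S.IsCongruence ρ) : S.Aut →* Equiv.Perm (Quotient ρ) :=
  inducedHom S.Aut (Quotient.mk ρ) Quotient.mk_surjective h.fibresInvariant

/-- A finite cover `π : C → W` of the permutation structure `S` with domain `W`. -/
structure FiniteCover {W : Type u} (S : PermStructure W) (C : Type v) extends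
    PermStructure C where
  proj : C → W
  surjective : Function.Surjective proj
  finite_fibre : ∀ w, (proj ⁻¹' {w}).Finite
  invariant : FibresInvariant Aut proj
  range_eq : (inducedHom Aut proj surjective invariant).range = S.Aut

namespace FiniteCover

variable {W : Type u} {S : PermStructure W} {C : Type v} (π : FiniteCover S C)

/-- The map `μ : Aut(C) → Sym(W)`, with image `Aut(W)`. -/
noncomputable def μ : π.Aut →* Equiv.Perm W :=
  inducedHom π.Aut π.proj π.surjective π.invariant

/-- The kernel of the cover, as a permutation group on `C`. -/
noncomputable def kernel : Subgroup (Equiv.Perm C) :=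
  inducedKer π.Aut π.proj π.surjective π.invariant

/-- `C(A)`, the union of the fibres over the points of `A`. -/
def above (A : Set W) : Set C := π.proj ⁻¹' A

/-- `F(A)`: the permutation group induced on `C(A)` by the setwise stabilizer of `A` in
`Aut(C)`. An element of `Aut(C)` stabilizes `A` (via `μ`) iff it stabilizes `C(A)`. -/
def fibreGroup (A : Set W) : Subgroup (Equiv.Perm (π.above A)) :=
  inducedOn (setStab π.Aut (π.above A)) (π.above A)

/-- `B(A) = K(A)`: the permutation group induced on `C(A)` by the kernel. For `A = {w}` this is
the binding group at `w`. -/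
noncomputable def bindingGroup (A : Set W) : Subgroup (Equiv.Perm (π.above A)) :=
  inducedOn π.kernel (π.above A)

/-- Every `g ∈ Aut(W/{A})` extends to an automorphism of `C`, whose restriction to `C(A)` is in
`F(A)`. -/
theorem exists_extension (A : Set W) (g : setStab S.Aut A) :
    ∃ t : π.fibreGroup A, ∃ h : π.Aut, π.μ h = g ∧
      ∀ c : π.above A, (h : Equiv.Perm C) c = (t : Equiv.Perm (π.above A)) c := by
  have hg : (g : Equiv.Perm W) ∈ π.μ.range := by
    have := π.range_eq
    rw [μ, this]
    exact g.2.1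
  obtain ⟨h, hh⟩ := hg
  have hA : ∀ c, (h : Equiv.Perm C) c ∈ π.above A ↔ c ∈ π.above A := fun c => by
    have h1 : π.μ h (π.proj c) = π.proj ((h : Equiv.Perm C) c) := inducedHom_apply _ _ _ _ h c
    change π.proj ((h : Equiv.Perm C) c) ∈ A ↔ π.proj c ∈ A
    rw [← h1, hh]
    exact g.2.2 _
  exact ⟨⟨(h : Equiv.Perm C).subtypePerm hA, h, ⟨h.2, hA⟩, fun _ => rfl⟩, h, hh, fun _ => rfl⟩

/-- The canonical map `χ_A : Aut(W/{A}) → F(A)/B(A)`: `χ_A(g)` is the class of the restriction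
to `C(A)` of any automorphism of `C` that extends `g`. -/
noncomputable def chi (A : Set W) (g : setStab S.Aut A) :
    π.fibreGroup A ⧸ (π.bindingGroup A).subgroupOf (π.fibreGroup A) :=
  QuotientGroup.mk (π.exists_extension A g).choose

/-- `χ_A` does not depend on the choice of the extension. -/
theorem chi_eq (A : Set W) (g : setStab S.Aut A) (t : π.fibreGroup A) (h : π.Aut)
    (hg : π.μ h = g)
    (ht : ∀ c : π.above A, (h : Equiv.Perm C) c = (t : Equiv.Perm (π.above A)) c) :
    π.chi A g = QuotientGroup.mk t := by
  obtain ⟨h', hg', ht'⟩ := (π.exists_extension A g).choose_spec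
  rw [chi, QuotientGroup.eq]
  refine ⟨((h'⁻¹ * h : π.Aut) : Equiv.Perm C), ⟨h'⁻¹ * h, ?_, rfl⟩, fun c => ?_⟩
  · change π.μ (h'⁻¹ * h) = 1
    rw [map_mul, map_inv, hg, hg', inv_mul_cancel]
  · have h1 := ht c
    have h2 := ht' (((π.exists_extension A g).choose : Equiv.Perm (π.above A))⁻¹
      ((t : Equiv.Perm (π.above A)) c))
    rw [perm_apply_inv] at h2
    change (h' : Equiv.Perm C)⁻¹ ((h : Equiv.Perm C) c) = _
    rw [h1, ← h2, perm_inv_apply]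
    rfl

/-- `π` is almost free with respect to `ρ`, with binding groups isomorphic to `G`. -/
structure IsAlmostFree (ρ : Setoid W) (G : Type w) [Group G] : Prop where
  binding : ∀ w, Nonempty (π.bindingGroup {w} ≃* G)
  same_class : ∀ w, Nonempty (π.bindingGroup (cls ρ w) ≃* G)
  distinct_classes : ∀ w₁ w₂, ¬ ρ w₁ w₂ → Nonempty (π.bindingGroup {w₁, w₂} ≃* G × G)

/-- The kernel is the full direct product, over the `ρ`-classes `r`, of the groups that it induces
on the sets `C(r)`: any family of kernel elements, one for each class, can be glued together to
a kernel element. -/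
def KernelIsFullProduct (ρ : Setoid W) : Prop :=
  ∀ k : Quotient ρ → Equiv.Perm C, (∀ r, k r ∈ π.kernel) →
    ∃ g ∈ π.kernel, ∀ c, g c = k (Quotient.mk ρ (π.proj c)) c

/-- Isomorphism over `W` of finite covers of `W`. -/
def IsoOver {C' : Type w} (π : FiniteCover S C) (π' : FiniteCover S C') : Prop :=
  ∃ α : C ≃ C', (∀ c, π'.proj (α c) = π.proj c) ∧
    π.Aut.map α.permCongrHom.toMonoidHom = π'.Aut

end FiniteCover

/-! ### The data at a class -/

/-- The data at the class `A`: a closed permutation group `F` on a set `X` and a finite-to-one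
surjection `σ : X → A` with `F`-invariant fibres, such that the image of the induced map
`T : F → Sym(A)` is the group induced by `Aut(W/{A})` on `A`. -/
structure ClassData {W : Type u} (S : PermStructure W) (A : Set W) (X : Type v) where
  F : Subgroup (Equiv.Perm X)
  isClosed_F : IsClosed (F : Set (Equiv.Perm X))
  σ : X → A
  surjective : Function.Surjective σ
  finite_fibre : ∀ a, (σ ⁻¹' {a}).Finite
  invariant : FibresInvariant F σ
  range_eq : (inducedHom F σ surjective invariant).range = inducedOn (setStab S.Aut A) A

namespace ClassData

variable {W : Type u} {S : PermStructure W} {A : Set W} {X : Type v} (D : ClassData S A X)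

/-- The induced map `T : F → Sym(A)`. -/
noncomputable def T : D.F →* Equiv.Perm A :=
  inducedHom D.F D.σ D.surjective D.invariant

/-- The kernel `B` of `T`, as a permutation group on `X`. -/
noncomputable def B : Subgroup (Equiv.Perm X) :=
  inducedKer D.F D.σ D.surjective D.invariant

noncomputable instance : (D.B.subgroupOf D.F).Normal :=
  inducedKer_normal D.F D.σ D.surjective D.invariant

/-- The permutation group `G` induced by `B` on the fibre `σ⁻¹(a)`. -/
noncomputable def G (a : A) : Subgroup (Equiv.Perm (D.σ ⁻¹' {a})) :=
  inducedOn D.B (D.σ ⁻¹' {a})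

theorem exists_lift (g : setStab S.Aut A) :
    ∃ f : D.F, ∀ a : A, (D.T f a : W) = (g : Equiv.Perm W) a := by
  have hg : (g : Equiv.Perm W).subtypePerm g.2.2 ∈ D.T.range := by
    have := D.range_eq
    rw [T, this]
    exact ⟨g, g.2, fun _ => rfl⟩
  obtain ⟨f, hf⟩ := hg
  exact ⟨f, fun a => by rw [hf]; rfl⟩

/-- The map `χ : Aut(W/{A}) → F/B`, `χ(g) = fB` for any `f ∈ F` with `T(f) = g|A`. -/
noncomputable def chi (g : setStab S.Aut A) : D.F ⧸ D.B.subgroupOf D.F :=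
  QuotientGroup.mk (D.exists_lift g).choose

/-- `χ` does not depend on the choice of the lift. -/
theorem chi_eq (g : setStab S.Aut A) (f : D.F)
    (hf : ∀ a : A, (D.T f a : W) = (g : Equiv.Perm W) a) :
    D.chi g = QuotientGroup.mk f := by
  have hf' := (D.exists_lift g).choose_spec
  have hT : D.T (D.exists_lift g).choose = D.T f := by
    ext a
    rw [hf, hf']
  rw [chi, QuotientGroup.eq]
  refine ⟨(D.exists_lift g).choose⁻¹ * f, ?_, rfl⟩
  change D.T ((D.exists_lift g).choose⁻¹ * f) = 1
  rw [map_mul, map_inv, hT, inv_mul_cancel]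

/-- The finite cover `π` has the data `D` at `A`: there is a bijection `γ : C(A) → X` over `A`
that carries `F(A)` to `F` and `B(A)` to `B`, and whose induced isomorphism
`F(A)/B(A) → F/B` carries `χ_A` to `χ`. -/
def IsDataOf {C : Type w} (π : FiniteCover S C) : Prop :=
  ∃ γ : π.above A ≃ X,
    (∀ c : π.above A, (D.σ (γ c) : W) = π.proj c) ∧
    (π.fibreGroup A).map γ.permCongrHom.toMonoidHom = D.F ∧
    (π.bindingGroup A).map γ.permCongrHom.toMonoidHom = D.B ∧
    ∀ (g : setStab S.Aut A) (t : π.fibreGroup A) (f : D.F),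
      (f : Equiv.Perm X) = γ.permCongrHom (t : Equiv.Perm (π.above A)) →
        (π.chi A g = QuotientGroup.mk t ↔ D.chi g = QuotientGroup.mk f)

end ClassData

/-- Two permutation groups are isomorphic as permutation groups. -/
def PermIso {X : Type u} {Y : Type v} (P : Subgroup (Equiv.Perm X)) (Q : Subgroup (Equiv.Perm Y)) :
    Prop :=
  ∃ e : X ≃ Y, P.map e.permCongrHom.toMonoidHom = Q

end FinCov

open FinCov

/-!
Write `A = [w₀]`, and choose automorphisms `t r` of `W` that carry `A` to each class `r`. The
standard cover lives on `W/ρ × X`: the copy of `X` at `r` lies over `r` through `t r ∘ σ`, and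
the automorphisms are the permutations that lie over an element of `Aut(W)` and carry each copy
of `X` to another one by an element of `F` (`stdAut`). Every `g ∈ Aut(W)` lifts, because
`(t s)⁻¹ * g * t r` stabilizes `A` and so lifts to `F` (`exists_stdAut_above`); the group is closed
because `Aut(W)` and `F` are (`isClosed_stdAut`); and its kernel is the power of `B` indexed by
the classes (`mem_kernel_stdCover`). Since `B` is the whole kernel of `F` on `A`, the coset
`χ(g)` consists of all elements of `F` that act on `A` as `g`. Hence agreement of the maps `χ`
follows from agreement of `F` and `B` (`ClassData.isDataOf_of_map_eq`).

For uniqueness, lifts of the `t r` to a cover `π` with the same data identify `π` with the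
standard cover as a set over `W`, and `Aut(C)` with a subgroup of `stdAut` that still maps onto
`Aut(W)`. So the two groups are equal once the kernels are, which is clear if the kernel of `π`
is a full product (`isoOver_stdCover`).

If `G` is perfect, the kernel of an almost free cover is automatically the full product. By
counting, the action of an element of the kernel `K` on a class is determined by its action on
one fibre of that class, and `K` acts independently on two distinct classes. If normal subgroups
`M` and `N` of `K` induce all of `K(r)` on a class `r`, then so does `M ⊓ N ≥ ⁅M, N⁆`, because
`K(r)` is perfect (`map_inf_eq_top_of_isPerfect`). Applied to the pointwise stabilizers of other
classes, this gives independence on any finite set of classes, and the closedness of `Aut(C)`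
extends it to all classes (`IsAlmostFree.kernelIsFullProduct_of_isPerfect`).
-/

namespace FinCov

/-! ### Permutation groups -/

/-- A set of permutations is closed iff it contains every permutation that it approximates on
every finite set. -/
theorem isClosed_iff_approx {Ω : Type u} {P : Set (Equiv.Perm Ω)} :
    IsClosed P ↔ ∀ g : Equiv.Perm Ω,
      (∀ Γ : Finset Ω, ∃ h ∈ P, ∀ x ∈ Γ, h x = g x) → g ∈ P := by
  rw [← isOpen_compl_iff]
  constructor
  · intro hP g hg
    by_contra hgP
    obtain ⟨Γ, hΓ⟩ := hP g hgP
    obtain ⟨h, hh, hhg⟩ := hg Γ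
    exact hΓ h hhg hh
  · intro hP g hg
    by_contra! hne
    refine hg (hP g fun Γ => ?_)
    obtain ⟨h, hhg, hh⟩ := hne Γ
    exact ⟨h, not_not.mp hh, hhg⟩

theorem PermIso.nonempty_mulEquiv {X : Type u} {Y : Type v} {P : Subgroup (Equiv.Perm X)}
    {Q : Subgroup (Equiv.Perm Y)} (h : PermIso P Q) : Nonempty (P ≃* Q) := by
  obtain ⟨e, rfl⟩ := h
  exact ⟨P.equivMapOfInjective _ e.permCongrHom.injective⟩

/-- A criterion for a bijection to carry one permutation group to another. -/
theorem map_permCongrHom_eq {X : Type u} {Y : Type v} {P : Subgroup (Equiv.Perm X)}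
    {Q : Subgroup (Equiv.Perm Y)} (e : X ≃ Y)
    (h₁ : ∀ g ∈ P, ∃ q ∈ Q, ∀ x, e (g x) = q (e x))
    (h₂ : ∀ q ∈ Q, ∃ g ∈ P, ∀ x, e (g x) = q (e x)) :
    P.map e.permCongrHom.toMonoidHom = Q := by
  have key : ∀ (g : Equiv.Perm X) (q : Equiv.Perm Y), (∀ x, e (g x) = q (e x)) →
      e.permCongrHom.toMonoidHom g = q := fun g q hgq => by
    ext y
    change e (g (e.symm y)) = q y
    rw [hgq, e.apply_symm_apply]
  ext q
  constructor
  · rintro ⟨g, hg, rfl⟩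
    obtain ⟨q, hq, hgq⟩ := h₁ g hg
    rwa [key g q hgq]
  · intro hq
    obtain ⟨g, hg, hgq⟩ := h₂ q hq
    exact ⟨g, hg, key g q hgq⟩

theorem exists_of_map_permCongrHom_eq {X : Type u} {Y : Type v} {P : Subgroup (Equiv.Perm X)}
    {Q : Subgroup (Equiv.Perm Y)} {e : X ≃ Y} (h : P.map e.permCongrHom.toMonoidHom = Q) :
    (∀ g ∈ P, ∃ q ∈ Q, ∀ x, e (g x) = q (e x)) ∧ ∀ q ∈ Q, ∃ g ∈ P, ∀ x, e (g x) = q (e x) := by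
  subst h
  have key : ∀ (g : Equiv.Perm X) (x : X),
      e (g x) = e.permCongrHom.toMonoidHom g (e x) := fun g x => by
    change _ = e (g (e.symm (e x)))
    rw [e.symm_apply_apply]
  refine ⟨fun g hg => ⟨_, ⟨g, hg, rfl⟩, key g⟩, ?_⟩
  rintro _ ⟨g, hg, rfl⟩
  exact ⟨g, hg, key g⟩

/-- The restriction homomorphism from a permutation group that stabilizes `A` to the group that
it induces on `A`. -/
def restrict {Ω : Type u} (P : Subgroup (Equiv.Perm Ω)) (A : Set Ω)
    (hA : ∀ g ∈ P, ∀ x, g x ∈ A ↔ x ∈ A) : P →* inducedOn P A where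
  toFun g := ⟨(g : Equiv.Perm Ω).subtypePerm (hA g g.2), g, g.2, fun _ => rfl⟩
  map_one' := rfl
  map_mul' _ _ := rfl

theorem restrict_surjective {Ω : Type u} (P : Subgroup (Equiv.Perm Ω)) (A : Set Ω)
    (hA : ∀ g ∈ P, ∀ x, g x ∈ A ↔ x ∈ A) : Function.Surjective (restrict P A hA) := by
  rintro ⟨t, g, hg, hgt⟩
  exact ⟨⟨g, hg⟩, Subtype.ext (Equiv.ext fun x => Subtype.ext (hgt x))⟩

theorem restrict_eq_iff {Ω : Type u} {P : Subgroup (Equiv.Perm Ω)} {A : Set Ω}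
    {hA : ∀ g ∈ P, ∀ x, g x ∈ A ↔ x ∈ A} {g h : P} :
    restrict P A hA g = restrict P A hA h ↔
      ∀ x ∈ A, (g : Equiv.Perm Ω) x = (h : Equiv.Perm Ω) x :=
  ⟨fun e x hx => congrArg (fun t : inducedOn P A => ((t : Equiv.Perm A) ⟨x, hx⟩ : Ω)) e,
    fun e => Subtype.ext (Equiv.ext fun x => Subtype.ext (e x x.2))⟩

/-! ### Perfect quotients and finite groups -/

/-- In a group with a perfect quotient, the normal subgroups that map onto the quotient are closed
under intersection: `M ⊓ N` contains `⁅M, N⁆`, whose image is the commutator subgroup. -/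
theorem map_inf_eq_top_of_isPerfect {K : Type u} {G : Type v} [Group K] [Group G]
    [Group.IsPerfect G] (q : K →* G) (M N : Subgroup K) [M.Normal] [N.Normal]
    (hM : M.map q = ⊤) (hN : N.map q = ⊤) : (M ⊓ N).map q = ⊤ := by
  refine top_le_iff.mp ?_
  calc (⊤ : Subgroup G) = ⁅(⊤ : Subgroup G), ⊤⁆ := (Group.IsPerfect.commutator_eq_top (G := G)).symm
    _ = Subgroup.map q ⁅M, N⁆ := by rw [Subgroup.map_commutator, hM, hN]
    _ ≤ (M ⊓ N).map q := Subgroup.map_mono (Subgroup.commutator_le_inf M N)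

/-- If two quotients of a group have the same finite order and one kernel contains the other,
the kernels are equal. -/
theorem ker_le_ker_of_card_eq {K : Type u} {G : Type v} {H : Type w} [Group K] [Group G] [Group H]
    (p : K →* G) (q : K →* H) (hp : Function.Surjective p) (hq : Function.Surjective q)
    [Finite G] (hc : Nat.card G = Nat.card H) (hle : p.ker ≤ q.ker) : q.ker ≤ p.ker := by
  have hi := Subgroup.relIndex_mul_index hle
  rw [Subgroup.index_ker, Subgroup.index_ker, MonoidHom.range_eq_top.mpr hp,
    MonoidHom.range_eq_top.mpr hq, Subgroup.card_top, Subgroup.card_top, hc] at hi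
  have hpos : 0 < Nat.card H := hc ▸ Nat.card_pos
  exact Subgroup.relIndex_eq_one.mp (Nat.eq_of_mul_eq_mul_right hpos (by rw [hi, one_mul]))

/-- If the image of a homomorphism `f` to a finite group has the order of that group, then `f` is
surjective. The image is given up to isomorphism as another quotient by `ker f`. -/
theorem surjective_of_ker_eq {K : Type u} {L : Type v} {G : Type w} [Group K] [Group L] [Group G]
    (f : K →* G) (p : K →* L) (hp : Function.Surjective p) [Finite G]
    (hc : Nat.card L = Nat.card G) (hk : f.ker = p.ker) : Function.Surjective f := by
  rw [← MonoidHom.range_eq_top]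
  apply Subgroup.eq_top_of_card_eq
  rw [← Subgroup.index_ker, hk, Subgroup.index_ker, MonoidHom.range_eq_top.mpr hp,
    Subgroup.card_top, hc]

namespace FiniteCover

/-! ### The kernel of a finite cover -/

variable {W : Type u} {S : PermStructure W} {C : Type v} (π : FiniteCover S C)

theorem exists_base {h : Equiv.Perm C} (hh : h ∈ π.Aut) :
    ∃ g ∈ S.Aut, ∀ c, π.proj (h c) = g (π.proj c) :=
  ⟨π.μ ⟨h, hh⟩, π.range_eq ▸ ⟨⟨h, hh⟩, rfl⟩, fun c => (inducedHom_apply _ _ _ _ ⟨h, hh⟩ c).symm⟩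

theorem exists_above {g : Equiv.Perm W} (hg : g ∈ S.Aut) :
    ∃ h ∈ π.Aut, ∀ c, π.proj (h c) = g (π.proj c) := by
  rw [← π.range_eq] at hg
  obtain ⟨h, rfl⟩ := hg
  exact ⟨h, h.2, fun c => (inducedHom_apply _ _ _ _ h c).symm⟩

theorem mem_kernel {g : Equiv.Perm C} :
    g ∈ π.kernel ↔ g ∈ π.Aut ∧ ∀ c, π.proj (g c) = π.proj c :=
  mem_inducedKer _ _ _ _ g

theorem conj_mem_kernel {h k : Equiv.Perm C} (hh : h ∈ π.Aut) (hk : k ∈ π.kernel) :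
    h * k * h⁻¹ ∈ π.kernel := by
  obtain ⟨g, -, hg⟩ := π.exists_base hh
  rw [mem_kernel] at hk ⊢
  refine ⟨π.Aut.mul_mem (π.Aut.mul_mem hh hk.1) (π.Aut.inv_mem hh), fun c => ?_⟩
  change π.proj (h (k (h⁻¹ c))) = _
  rw [hg, hk.2, ← hg, perm_apply_inv]

/-- Restriction of the kernel to the part of the cover above `A`. -/
noncomputable def kernelRestrict (A : Set W) : π.kernel →* π.bindingGroup A :=
  restrict π.kernel (π.above A) fun g hg x => by
    change π.proj (g x) ∈ A ↔ π.proj x ∈ A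
    rw [(π.mem_kernel.mp hg).2 x]

theorem kernelRestrict_surjective (A : Set W) : Function.Surjective (π.kernelRestrict A) :=
  restrict_surjective _ _ _

theorem kernelRestrict_eq_iff {A : Set W} {k k' : π.kernel} :
    π.kernelRestrict A k = π.kernelRestrict A k' ↔
      ∀ c, π.proj c ∈ A → (k : Equiv.Perm C) c = (k' : Equiv.Perm C) c :=
  restrict_eq_iff

theorem mem_ker_kernelRestrict {A : Set W} {k : π.kernel} :
    k ∈ (π.kernelRestrict A).ker ↔ ∀ c, π.proj c ∈ A → (k : Equiv.Perm C) c = c := by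
  rw [MonoidHom.mem_ker, ← map_one (π.kernelRestrict A), kernelRestrict_eq_iff]
  rfl

theorem ker_kernelRestrict_prod (a b : W) :
    ((π.kernelRestrict {a}).prod (π.kernelRestrict {b})).ker = (π.kernelRestrict {a, b}).ker := by
  ext k
  rw [MonoidHom.ker_prod, Subgroup.mem_inf, mem_ker_kernelRestrict, mem_ker_kernelRestrict,
    mem_ker_kernelRestrict]
  constructor
  · rintro ⟨h₁, h₂⟩ c (hc | hc)
    exacts [h₁ c hc, h₂ c hc]
  · exact fun h => ⟨fun c hc => h c (Or.inl hc), fun c hc => h c (Or.inr hc)⟩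

variable {π} in
/-- If the kernel is the full product, then above two points in different classes it acts as the
product of the binding groups. -/
theorem KernelIsFullProduct.nonempty_mulEquiv {ρ : Setoid W}
    (h : π.KernelIsFullProduct ρ) {a b : W} (hab : ¬ ρ a b) :
    Nonempty (π.bindingGroup {a, b} ≃* π.bindingGroup {a} × π.bindingGroup {b}) := by
  classical
  have hs : Function.Surjective ((π.kernelRestrict {a}).prod (π.kernelRestrict {b})) := by
    rintro ⟨p, q⟩
    obtain ⟨k, rfl⟩ := π.kernelRestrict_surjective _ p
    obtain ⟨l, rfl⟩ := π.kernelRestrict_surjective _ q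
    obtain ⟨g, hg, hgc⟩ := h (fun r => if r = Quotient.mk ρ a then k else l) fun r => by
      split_ifs
      exacts [k.2, l.2]
    refine ⟨⟨g, hg⟩, Prod.ext (π.kernelRestrict_eq_iff.mpr fun c hc => ?_)
      (π.kernelRestrict_eq_iff.mpr fun c hc => ?_)⟩
    · change g c = _
      rw [hgc, Set.mem_singleton_iff.mp hc, if_pos rfl]
    · change g c = _
      rw [hgc, Set.mem_singleton_iff.mp hc, if_neg fun e => hab (ρ.symm (Quotient.exact e))]
  exact ⟨(QuotientGroup.quotientKerEquivOfSurjective _ (π.kernelRestrict_surjective _)).symm.trans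
    ((QuotientGroup.quotientMulEquivOfEq (π.ker_kernelRestrict_prod a b).symm).trans
      (QuotientGroup.quotientKerEquivOfSurjective _ hs))⟩

/-! ### Perfect binding groups -/

section AlmostFree

variable {π} {ρ : Setoid W} {G : Type w} [Group G] [Finite G]

/-- A kernel element is determined on a whole class by its action on a single fibre: the
kernel induces groups of the same finite order on both. -/
theorem IsAlmostFree.ker_kernelRestrict_le (h : π.IsAlmostFree ρ G) (a : W) :
    (π.kernelRestrict {a}).ker ≤ (π.kernelRestrict (cls ρ a)).ker := by
  obtain ⟨e₁⟩ := h.binding a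
  obtain ⟨e₂⟩ := h.same_class a
  have : Finite (π.bindingGroup (cls ρ a)) := Finite.of_equiv G e₂.symm.toEquiv
  refine ker_le_ker_of_card_eq _ _ (π.kernelRestrict_surjective _) (π.kernelRestrict_surjective _)
    (Nat.card_congr (e₂.trans e₁.symm).toEquiv) fun k hk => ?_
  rw [mem_ker_kernelRestrict] at hk ⊢
  intro c hc
  refine hk c ?_
  rw [Set.mem_singleton_iff.mp hc]
  exact ρ.refl a

/-- The kernel acts independently on two different classes. -/
theorem IsAlmostFree.exists_agree_of_distinct (h : π.IsAlmostFree ρ G) {a b : W}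
    (hab : ¬ ρ a b) (k : π.kernel) :
    ∃ k' : π.kernel, π.kernelRestrict (cls ρ a) k' = π.kernelRestrict (cls ρ a) k ∧
      k' ∈ (π.kernelRestrict (cls ρ b)).ker := by
  obtain ⟨ea⟩ := h.binding a
  obtain ⟨eb⟩ := h.binding b
  obtain ⟨eab⟩ := h.distinct_classes a b hab
  have : Finite (π.bindingGroup {a}) := Finite.of_equiv G ea.symm.toEquiv
  have : Finite (π.bindingGroup {b}) := Finite.of_equiv G eb.symm.toEquiv
  have hs : Function.Surjective ((π.kernelRestrict {a}).prod (π.kernelRestrict {b})) :=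
    surjective_of_ker_eq _ (π.kernelRestrict {a, b}) (π.kernelRestrict_surjective _)
      (Nat.card_congr (eab.trans (ea.prodCongr eb).symm).toEquiv) (π.ker_kernelRestrict_prod a b)
  obtain ⟨k', hk'⟩ := hs (π.kernelRestrict {a} k, 1)
  have h₁ : π.kernelRestrict {a} k' = π.kernelRestrict {a} k := congrArg Prod.fst hk'
  have h₂ : π.kernelRestrict {b} k' = 1 := congrArg Prod.snd hk'
  refine ⟨k', ?_, h.ker_kernelRestrict_le b h₂⟩
  rw [← inv_mul_eq_one, ← map_inv, ← map_mul] at h₁ ⊢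
  exact h.ker_kernelRestrict_le a h₁

/-- With a perfect binding group, independence on pairs of classes improves to independence of one
class from any finite set of other classes. -/
theorem IsAlmostFree.exists_agree_of_isPerfect [Group.IsPerfect G] (h : π.IsAlmostFree ρ G)
    (a : W) (J : Finset W) (hJ : ∀ b ∈ J, ¬ ρ a b) (k : π.kernel) :
    ∃ k' : π.kernel, π.kernelRestrict (cls ρ a) k' = π.kernelRestrict (cls ρ a) k ∧
      ∀ b ∈ J, k' ∈ (π.kernelRestrict (cls ρ b)).ker := by
  classical
  obtain ⟨e⟩ := h.same_class a
  have : Group.IsPerfect (π.bindingGroup (cls ρ a)) :=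
    Group.IsPerfect.ofSurjective (f := e.symm.toMonoidHom) e.symm.surjective
  let q := π.kernelRestrict (cls ρ a)
  let N : W → Subgroup π.kernel := fun b => (π.kernelRestrict (cls ρ b)).ker
  have hN : ∀ b ∈ J, (N b).map q = ⊤ := fun b hb => by
    rw [eq_top_iff]
    intro t _
    obtain ⟨k, rfl⟩ := π.kernelRestrict_surjective _ t
    obtain ⟨k', h₁, h₂⟩ := h.exists_agree_of_distinct (hJ b hb) k
    exact ⟨k', h₂, h₁⟩
  have key : ∀ J' ⊆ J, ∃ M : Subgroup π.kernel, M.Normal ∧ (∀ b ∈ J', M ≤ N b) ∧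
      M.map q = ⊤ := by
    intro J'
    induction J' using Finset.induction_on with
    | empty =>
      intro _
      refine ⟨⊤, inferInstance, by simp, ?_⟩
      rw [← MonoidHom.range_eq_map, MonoidHom.range_eq_top]
      exact π.kernelRestrict_surjective _
    | insert b J' _ ih =>
      intro hsub
      obtain ⟨M, hMn, hMle, hM⟩ := ih ((Finset.subset_insert b J').trans hsub)
      refine ⟨M ⊓ N b, inferInstance, fun c hc => ?_,
        map_inf_eq_top_of_isPerfect q M (N b) hM (hN b (hsub (Finset.mem_insert_self b J')))⟩
      rcases Finset.mem_insert.mp hc with rfl | hc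
      exacts [inf_le_right, inf_le_left.trans (hMle c hc)]
  obtain ⟨M, -, hMle, hM⟩ := key J subset_rfl
  obtain ⟨k', hk', hq⟩ : q k ∈ M.map q := hM ▸ Subgroup.mem_top _
  exact ⟨k', hq, fun b hb => hMle b hb hk'⟩

/-- Gluing kernel elements over finitely many classes. -/
theorem IsAlmostFree.exists_glue_of_isPerfect [Group.IsPerfect G] (h : π.IsAlmostFree ρ G)
    (k : Quotient ρ → π.kernel) (J : Finset (Quotient ρ)) :
    ∃ g : π.kernel, ∀ c, Quotient.mk ρ (π.proj c) ∈ J →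
      (g : Equiv.Perm C) c = (k (Quotient.mk ρ (π.proj c)) : Equiv.Perm C) c := by
  classical
  induction J using Finset.induction_on with
  | empty => exact ⟨1, by simp⟩
  | insert r J hr ih =>
    obtain ⟨g, hg⟩ := ih
    -- correct `g` on the class `r` by an element that is trivial on the classes in `J`
    obtain ⟨d, hd, hd'⟩ := h.exists_agree_of_isPerfect r.out (J.image Quotient.out)
      (fun b hb hrb => by
        obtain ⟨s, hs, rfl⟩ := Finset.mem_image.mp hb
        have := Quotient.sound hrb
        rw [Quotient.out_eq, Quotient.out_eq] at this
        exact hr (this ▸ hs)) (g⁻¹ * k r)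
    refine ⟨g * d, fun c hc => ?_⟩
    change (g : Equiv.Perm C) ((d : Equiv.Perm C) c) = _
    rcases Finset.mem_insert.mp hc with hc | hc
    · have hcr : π.proj c ∈ cls ρ r.out := Quotient.exact (hc.trans r.out_eq.symm)
      rw [hc, π.kernelRestrict_eq_iff.mp hd c hcr]
      exact perm_apply_inv (g : Equiv.Perm C) _
    · have hcJ := π.mem_ker_kernelRestrict.mp (hd' _ (Finset.mem_image_of_mem _ hc)) c
        (Quotient.exact (Quotient.out_eq _).symm)
      rw [hcJ, hg c hc]

/-- With a perfect binding group, the kernel of an almost free cover is the full product over the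
classes: finite gluings lie in the kernel, and the automorphism group is closed. -/
theorem IsAlmostFree.kernelIsFullProduct_of_isPerfect [Group.IsPerfect G]
    (h : π.IsAlmostFree ρ G) : π.KernelIsFullProduct ρ := by
  classical
  intro k hk
  have hproj : ∀ r c, π.proj (k r c) = π.proj c := fun r => (π.mem_kernel.mp (hk r)).2
  have hproj' : ∀ r c, π.proj ((k r)⁻¹ c) = π.proj c :=
    fun r => (π.mem_kernel.mp (π.kernel.inv_mem (hk r))).2
  let g : Equiv.Perm C :=
    { toFun := fun c => k (Quotient.mk ρ (π.proj c)) c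
      invFun := fun c => (k (Quotient.mk ρ (π.proj c)))⁻¹ c
      left_inv := fun c => by
        change (k (Quotient.mk ρ (π.proj (k _ c))))⁻¹ _ = c
        rw [hproj, perm_inv_apply]
      right_inv := fun c => by
        change k (Quotient.mk ρ (π.proj ((k _)⁻¹ c))) _ = c
        rw [hproj', perm_apply_inv] }
  refine ⟨g, π.mem_kernel.mpr ⟨?_, fun c => hproj _ c⟩, fun c => rfl⟩
  refine isClosed_iff_approx.mp π.isClosed_Aut g fun Γ => ?_
  obtain ⟨d, hd⟩ := h.exists_glue_of_isPerfect (fun r => ⟨k r, hk r⟩)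
    (Γ.image fun c => Quotient.mk ρ (π.proj c))
  exact ⟨d, (π.mem_kernel.mp d.2).1, fun c hc => hd c (Finset.mem_image_of_mem _ hc)⟩

end AlmostFree

end FiniteCover

namespace ClassData

/-! ### Elementary facts about class data -/

variable {W : Type u} {S : PermStructure W} {A : Set W} {X : Type v} (D : ClassData S A X)

theorem mem_B {f : Equiv.Perm X} : f ∈ D.B ↔ f ∈ D.F ∧ ∀ x, D.σ (f x) = D.σ x :=
  mem_inducedKer _ _ _ _ f

theorem conj_mem_B {f b : Equiv.Perm X} (hf : f ∈ D.F) (hb : b ∈ D.B) : f * b * f⁻¹ ∈ D.B := by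
  rw [mem_B] at hb ⊢
  refine ⟨D.F.mul_mem (D.F.mul_mem hf hb.1) (D.F.inv_mem hf), fun x => ?_⟩
  refine (D.invariant f hf _ _ (hb.2 (f⁻¹ x))).trans ?_
  rw [perm_apply_inv]

theorem exists_lift_mem {g : Equiv.Perm W} (hg : g ∈ setStab S.Aut A) :
    ∃ f ∈ D.F, ∀ x, (D.σ (f x) : W) = g (D.σ x) := by
  obtain ⟨f, hf⟩ := D.exists_lift ⟨g, hg⟩
  refine ⟨f, f.2, fun x => ?_⟩
  rw [← hf]
  exact congrArg Subtype.val (inducedHom_apply _ _ _ D.invariant f x).symm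

/-- A cover has the data `D` as soon as some bijection over `A` carries `F(A)` to `F` and `B(A)` to
`B`: since `B` is the whole kernel of `F` on `A`, the maps `χ` then correspond as well. -/
theorem isDataOf_of_map_eq {C : Type w} {π : FiniteCover S C} (γ : π.above A ≃ X)
    (hσ : ∀ c : π.above A, (D.σ (γ c) : W) = π.proj c)
    (hF : (π.fibreGroup A).map γ.permCongrHom.toMonoidHom = D.F)
    (hB : (π.bindingGroup A).map γ.permCongrHom.toMonoidHom = D.B) : D.IsDataOf π := by
  refine ⟨γ, hσ, hF, hB, fun g t f hf => ?_⟩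
  obtain ⟨t', h, hhg, hht⟩ := π.exists_extension A g
  have hf'F : γ.permCongrHom (t' : Equiv.Perm (π.above A)) ∈ D.F := hF ▸ ⟨t', t'.2, rfl⟩
  have hf' : ∀ a : A, (D.T ⟨_, hf'F⟩ a : W) = (g : Equiv.Perm W) a := fun a => by
    obtain ⟨x, rfl⟩ := D.surjective a
    have h₁ : D.T ⟨_, hf'F⟩ (D.σ x) = D.σ (γ ((t' : Equiv.Perm (π.above A)) (γ.symm x))) :=
      inducedHom_apply _ _ _ D.invariant ⟨_, hf'F⟩ x
    have h₂ : π.μ h (π.proj (γ.symm x)) = π.proj ((h : Equiv.Perm C) (γ.symm x)) :=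
      inducedHom_apply _ _ _ _ h _
    rw [h₁, hσ, ← hht, ← h₂, hhg, ← hσ, γ.apply_symm_apply]
  rw [π.chi_eq A g t' h hhg hht, D.chi_eq g ⟨_, hf'F⟩ hf', QuotientGroup.eq, QuotientGroup.eq,
    Subgroup.mem_subgroupOf, Subgroup.mem_subgroupOf, ← hB]
  have hmul : ((⟨_, hf'F⟩⁻¹ * f : D.F) : Equiv.Perm X) =
      γ.permCongrHom.toMonoidHom ((t'⁻¹ * t : π.fibreGroup A) : Equiv.Perm (π.above A)) := by
    change (γ.permCongrHom _)⁻¹ * (f : Equiv.Perm X) = γ.permCongrHom _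
    rw [hf, ← map_inv, ← map_mul]
    rfl
  rw [hmul]
  exact (Subgroup.mem_map_iff_mem γ.permCongrHom.injective).symm

end ClassData

/-! ### The standard cover -/

theorem PermStructure.IsCongruence.mem_setStab_cls {W : Type u} {S : PermStructure W}
    {ρ : Setoid W} (hρ : S.IsCongruence ρ) {w₀ a : W} {g : Equiv.Perm W} (hg : g ∈ S.Aut)
    (ha : a ∈ cls ρ w₀) (hga : g a ∈ cls ρ w₀) : g ∈ setStab S.Aut (cls ρ w₀) := by
  have key : ∀ x, ρ (g x) (g a) ↔ ρ x a := fun x =>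
    ⟨fun h => by simpa using hρ _ (S.Aut.inv_mem hg) _ _ h, hρ g hg x a⟩
  refine ⟨hg, fun x => ?_⟩
  exact ⟨fun h => ρ.trans ((key x).mp (ρ.trans h (ρ.symm hga))) ha,
    fun h => ρ.trans ((key x).mpr (ρ.trans h (ρ.symm ha))) hga⟩

/-- Automorphisms `t r` that carry the class of `w₀` to each class `r`, normalized to be the
identity at the class of `w₀` itself. -/
structure Transversal {W : Type u} (S : PermStructure W) (ρ : Setoid W) (w₀ : W) where
  t : Quotient ρ → Equiv.Perm W
  mem : ∀ r, t r ∈ S.Aut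
  mk_apply : ∀ r, Quotient.mk ρ (t r w₀) = r
  base : t (Quotient.mk ρ w₀) = 1

theorem PermStructure.IsTransitive.nonempty_transversal {W : Type u} {S : PermStructure W}
    (hS : S.IsTransitive) (ρ : Setoid W) (w₀ : W) : Nonempty (Transversal S ρ w₀) := by
  have : ∀ r : Quotient ρ, ∃ g ∈ S.Aut, Quotient.mk ρ (g w₀) = r ∧
      (r = Quotient.mk ρ w₀ → g = 1) := fun r => by
    by_cases hr : r = Quotient.mk ρ w₀
    · exact ⟨1, S.Aut.one_mem, hr.symm, fun _ => rfl⟩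
    · obtain ⟨g, hg, hgr⟩ := hS w₀ r.out
      exact ⟨g, hg, by rw [hgr, Quotient.out_eq], fun h => absurd h hr⟩
  choose t ht₁ ht₂ ht₃ using this
  exact ⟨⟨t, ht₁, ht₂, ht₃ _ rfl⟩⟩

namespace Transversal

variable {W : Type u} {S : PermStructure W} {ρ : Setoid W} {w₀ : W} (τ : Transversal S ρ w₀)

theorem apply_class (hρ : S.IsCongruence ρ) {r : Quotient ρ} {a : W} (ha : a ∈ cls ρ w₀) :
    Quotient.mk ρ (τ.t r a) = r :=
  (Quotient.sound (hρ _ (τ.mem r) _ _ ha)).trans (τ.mk_apply r)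

theorem inv_apply_mem (hρ : S.IsCongruence ρ) (w : W) : (τ.t (Quotient.mk ρ w))⁻¹ w ∈ cls ρ w₀ := by
  have h := hρ _ (S.Aut.inv_mem (τ.mem (Quotient.mk ρ w))) _ _
    (Quotient.exact (τ.mk_apply (Quotient.mk ρ w)))
  rw [perm_inv_apply] at h
  exact ρ.symm h

/-- Conjugating `g ∈ Aut(W)` by the transversal gives an element of the stabilizer of the class of
`w₀`, for every class `r`. -/
theorem conj_mem_setStab (hρ : S.IsCongruence ρ) {g : Equiv.Perm W} (hg : g ∈ S.Aut)
    {r s : Quotient ρ} (hrs : Quotient.mk ρ (g (τ.t r w₀)) = s) :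
    (τ.t s)⁻¹ * g * τ.t r ∈ setStab S.Aut (cls ρ w₀) := by
  subst hrs
  exact hρ.mem_setStab_cls
    (S.Aut.mul_mem (S.Aut.mul_mem (S.Aut.inv_mem (τ.mem _)) hg) (τ.mem _)) (ρ.refl w₀)
    (τ.inv_apply_mem hρ _)

end Transversal

section Standard

variable {W : Type u} {S : PermStructure W} {ρ : Setoid W} {w₀ : W} (τ : Transversal S ρ w₀)
  {X : Type v} (D : ClassData S (cls ρ w₀) X)

/-- The projection of the standard cover: over each class it is the copy of `σ` translated by the
transversal. -/
def stdProj (c : Quotient ρ × X) : W := τ.t c.1 (D.σ c.2)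

/-- The automorphism group of the standard cover: the permutations of `W/ρ × X` that lie over an
element of `Aut(W)` and carry each copy of `X` to another one by an element of `F`. -/
def stdAut : Subgroup (Equiv.Perm (Quotient ρ × X)) where
  carrier := {h | (∃ g ∈ S.Aut, ∀ c, stdProj τ D (h c) = g (stdProj τ D c)) ∧
    ∀ r, ∃ s, ∃ f ∈ D.F, ∀ x, h (r, x) = (s, f x)}
  one_mem' := ⟨⟨1, S.Aut.one_mem, fun _ => rfl⟩, fun r => ⟨r, 1, D.F.one_mem, fun _ => rfl⟩⟩
  mul_mem' := by
    rintro h h' ⟨⟨g, hg, hhg⟩, H⟩ ⟨⟨g', hg', hhg'⟩, H'⟩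
    refine ⟨⟨g * g', S.Aut.mul_mem hg hg', fun c => ?_⟩, fun r => ?_⟩
    · rw [Equiv.Perm.mul_apply, Equiv.Perm.mul_apply, hhg, hhg']
    · obtain ⟨s, f, hf, hs⟩ := H' r
      obtain ⟨s', f', hf', hs'⟩ := H s
      exact ⟨s', f' * f, D.F.mul_mem hf' hf, fun x => by
        rw [Equiv.Perm.mul_apply, hs, hs', Equiv.Perm.mul_apply]⟩
  inv_mem' := by
    rintro h ⟨⟨g, hg, hhg⟩, H⟩
    refine ⟨⟨g⁻¹, S.Aut.inv_mem hg, fun c => ?_⟩, fun r => ?_⟩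
    · have := hhg (h⁻¹ c)
      rw [perm_apply_inv] at this
      rw [this, perm_inv_apply]
    · obtain ⟨x₀, -⟩ := D.surjective ⟨w₀, ρ.refl w₀⟩
      obtain ⟨s, f, hf, hs⟩ := H (h⁻¹ (r, x₀)).1
      -- the copy of `X` through `h⁻¹ (r, x₀)` is carried by `h` to the copy at `r`
      have hsr : s = r := by
        have := hs (h⁻¹ (r, x₀)).2
        rw [Prod.mk.eta, perm_apply_inv] at this
        exact (congrArg Prod.fst this).symm
      subst hsr
      exact ⟨_, f⁻¹, D.F.inv_mem hf, fun x => by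
        rw [Equiv.Perm.inv_eq_iff_eq, hs, perm_apply_inv]⟩

theorem stdProj_surjective (hρ : S.IsCongruence ρ) : Function.Surjective (stdProj τ D) := by
  intro w
  obtain ⟨x, hx⟩ := D.surjective ⟨_, τ.inv_apply_mem hρ w⟩
  exact ⟨(Quotient.mk ρ w, x), by rw [stdProj, hx]; exact perm_apply_inv _ _⟩

theorem mk_stdProj (hρ : S.IsCongruence ρ) (c : Quotient ρ × X) :
    Quotient.mk ρ (stdProj τ D c) = c.1 :=
  τ.apply_class hρ (D.σ c.2).2

theorem stdProj_finite_fibre (hρ : S.IsCongruence ρ) (w : W) :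
    (stdProj τ D ⁻¹' {w}).Finite := by
  refine ((D.finite_fibre ⟨_, τ.inv_apply_mem hρ w⟩).image
    fun x => (Quotient.mk ρ w, x)).subset ?_
  rintro ⟨r, x⟩ hc
  have hc : stdProj τ D (r, x) = w := hc
  have hr : Quotient.mk ρ w = r := by rw [← hc, mk_stdProj τ D hρ]
  refine ⟨x, Subtype.ext ?_, Prod.ext hr rfl⟩
  change (D.σ x : W) = (τ.t (Quotient.mk ρ w))⁻¹ w
  rw [hr, ← hc, stdProj, perm_inv_apply]

/-- Every `g ∈ Aut(W)` lifts to the standard cover: lift the conjugates of `g` by the transversal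
to `F`, one class at a time. -/
theorem exists_stdAut_above (hρ : S.IsCongruence ρ) {g : Equiv.Perm W} (hg : g ∈ S.Aut) :
    ∃ h ∈ stdAut τ D, ∀ c, stdProj τ D (h c) = g (stdProj τ D c) := by
  let m : Equiv.Perm (Quotient ρ) := classHom hρ ⟨g, hg⟩
  have hm : ∀ w, m (Quotient.mk ρ w) = Quotient.mk ρ (g w) :=
    inducedHom_apply _ _ _ hρ.fibresInvariant ⟨g, hg⟩
  have hlift : ∀ r, ∃ f ∈ D.F, ∀ x,
      (D.σ (f x) : W) = ((τ.t (m r))⁻¹ * g * τ.t r) (D.σ x) := fun r =>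
    D.exists_lift_mem (τ.conj_mem_setStab hρ hg (by rw [← hm, τ.mk_apply]))
  choose f hf hfσ using hlift
  have hproj : ∀ c, stdProj τ D (Equiv.prodShear m f c) = g (stdProj τ D c) := fun c => by
    change τ.t (m c.1) (D.σ (f c.1 c.2)) = g (τ.t c.1 (D.σ c.2))
    rw [hfσ]
    exact perm_apply_inv _ _
  exact ⟨Equiv.prodShear m f, ⟨⟨g, hg, hproj⟩, fun r => ⟨m r, f r, hf r, fun _ => rfl⟩⟩, hproj⟩

/-- A permutation approximated on every finite set by elements of `stdAut` induces on `W` a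
permutation approximated by elements of `Aut(W)`, and on each copy of `X` a permutation
approximated by elements of `F`; both groups are closed. -/
theorem isClosed_stdAut (hρ : S.IsCongruence ρ) :
    IsClosed (stdAut τ D : Set (Equiv.Perm (Quotient ρ × X))) := by
  classical
  refine isClosed_iff_approx.mpr fun h happ => ?_
  obtain ⟨x₀, -⟩ := D.surjective ⟨w₀, ρ.refl w₀⟩
  have happ₂ : ∀ a b, ∃ h' ∈ stdAut τ D, h' a = h a ∧ h' b = h b := fun a b => by
    obtain ⟨h', hh', e⟩ := happ {a, b}
    exact ⟨h', hh', e a (by simp), e b (by simp)⟩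
  have hfib : ∀ a b, stdProj τ D (h a) = stdProj τ D (h b) ↔ stdProj τ D a = stdProj τ D b :=
    fun a b => by
    obtain ⟨h', ⟨⟨g, -, hg⟩, -⟩, ea, eb⟩ := happ₂ a b
    rw [← ea, ← eb, hg, hg, g.injective.eq_iff]
  have hfst : ∀ a b, (h a).1 = (h b).1 ↔ a.1 = b.1 := fun a b => by
    obtain ⟨h', hh', ea, eb⟩ := happ₂ a b
    constructor
    · intro e
      obtain ⟨s, f, -, hs⟩ := (stdAut τ D).inv_mem hh' |>.2 (h a).1
      have ha := hs (h a).2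
      have hb := hs (h b).2
      rw [Prod.mk.eta, ← ea, perm_inv_apply] at ha
      rw [e, Prod.mk.eta, ← eb, perm_inv_apply] at hb
      rw [ha, hb]
    · intro e
      obtain ⟨s, f, -, hs⟩ := hh'.2 a.1
      have ha := hs a.2
      have hb := hs b.2
      rw [Prod.mk.eta] at ha
      rw [e, Prod.mk.eta] at hb
      rw [← ea, ← eb, ha, hb]
  have hsurj := stdProj_surjective τ D hρ
  refine ⟨?_, fun r => ?_⟩
  · have hinv : ∀ c d, stdProj τ D c = stdProj τ D (h d) →
        stdProj τ D (h⁻¹ c) = stdProj τ D d := fun c d e => by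
      rw [← hfib, perm_apply_inv, e]
    let s := Function.surjInv hsurj
    have hs : ∀ w, stdProj τ D (s w) = w := Function.surjInv_eq hsurj
    let g : Equiv.Perm W :=
      { toFun := fun w => stdProj τ D (h (s w))
        invFun := fun w => stdProj τ D (h⁻¹ (s w))
        left_inv := fun w => (hinv _ _ (hs _)).trans (hs w)
        right_inv := fun w => by
          refine ((hfib _ _).mpr (hs _)).trans ?_
          rw [perm_apply_inv, hs] }
    have hg : ∀ c, stdProj τ D (h c) = g (stdProj τ D c) := fun c => ((hfib _ _).mpr (hs _)).symm
    refine ⟨g, isClosed_iff_approx.mp S.isClosed_Aut g fun Δ => ?_, hg⟩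
    obtain ⟨h', ⟨⟨g', hg', hhg'⟩, -⟩, e⟩ := happ (Δ.image s)
    refine ⟨g', hg', fun w hw => ?_⟩
    have := e (s w) (Finset.mem_image_of_mem s hw)
    rw [← hs w, ← hhg', ← hg, this]
  · have hfst₀ : ∀ x, (h (r, x)).1 = (h (r, x₀)).1 := fun x => (hfst _ _).mpr rfl
    have hfst₁ : ∀ y, (h⁻¹ ((h (r, x₀)).1, y)).1 = r := fun y => by
      refine (hfst _ (r, x₀)).mp ?_
      rw [perm_apply_inv]
    let f : Equiv.Perm X :=
      { toFun := fun x => (h (r, x)).2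
        invFun := fun y => (h⁻¹ ((h (r, x₀)).1, y)).2
        left_inv := fun x => by
          change (h⁻¹ ((h (r, x₀)).1, (h (r, x)).2)).2 = x
          rw [← hfst₀ x, Prod.mk.eta, perm_inv_apply]
        right_inv := fun y => by
          change (h (r, (h⁻¹ ((h (r, x₀)).1, y)).2)).2 = y
          have : (r, (h⁻¹ ((h (r, x₀)).1, y)).2) = h⁻¹ ((h (r, x₀)).1, y) :=
            Prod.ext (hfst₁ y).symm rfl
          rw [this, perm_apply_inv] }
    refine ⟨_, f, isClosed_iff_approx.mp D.isClosed_F f fun Γ => ?_,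
      fun x => Prod.ext (hfst₀ x) rfl⟩
    obtain ⟨h', ⟨-, H⟩, e⟩ := happ (Γ.image fun x => (r, x))
    obtain ⟨s, f', hf', hs⟩ := H r
    refine ⟨f', hf', fun x hx => ?_⟩
    have := e (r, x) (Finset.mem_image_of_mem _ hx)
    rw [hs] at this
    exact congrArg Prod.snd this

theorem stdAut_fibresInvariant : FibresInvariant (stdAut τ D) (stdProj τ D) := by
  rintro h ⟨⟨g, -, hg⟩, -⟩ a b e
  rw [hg, hg, e]

/-- The standard cover of `W` with data `D`, on `W/ρ × X`. -/
def stdCover (hρ : S.IsCongruence ρ) : FiniteCover S (Quotient ρ × X) where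
  Aut := stdAut τ D
  isClosed_Aut := isClosed_stdAut τ D hρ
  proj := stdProj τ D
  surjective := stdProj_surjective τ D hρ
  finite_fibre := stdProj_finite_fibre τ D hρ
  invariant := stdAut_fibresInvariant τ D
  range_eq := by
    have key : ∀ (h : stdAut τ D) (g : Equiv.Perm W),
        (∀ c, stdProj τ D ((h : Equiv.Perm _) c) = g (stdProj τ D c)) →
        inducedHom _ _ (stdProj_surjective τ D hρ) (stdAut_fibresInvariant τ D) h = g :=
      fun h g hg => by
      ext w
      obtain ⟨c, rfl⟩ := stdProj_surjective τ D hρ w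
      rw [inducedHom_apply, hg]
    ext g
    constructor
    · rintro ⟨h, rfl⟩
      obtain ⟨⟨g, hg, hhg⟩, -⟩ := h.2
      rwa [key h g hhg]
    · intro hg
      obtain ⟨h, hh, hhg⟩ := exists_stdAut_above τ D hρ hg
      exact ⟨⟨h, hh⟩, key ⟨h, hh⟩ g hhg⟩

/-! ### The kernel of the standard cover -/

/-- The kernel of the standard cover is the power of `B` indexed by the classes. -/
theorem mem_kernel_stdCover (hρ : S.IsCongruence ρ) {k : Equiv.Perm (Quotient ρ × X)} :
    k ∈ (stdCover τ D hρ).kernel ↔ ∀ r, ∃ b ∈ D.B, ∀ x, k (r, x) = (r, b x) := by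
  rw [FiniteCover.mem_kernel]
  constructor
  · rintro ⟨⟨-, H⟩, hk⟩ r
    obtain ⟨s, f, hf, hs⟩ := H r
    have hsr : s = r := by
      obtain ⟨x₀, -⟩ := D.surjective ⟨w₀, ρ.refl w₀⟩
      have h₁ := mk_stdProj τ D hρ (k (r, x₀))
      have h₂ : stdProj τ D (k (r, x₀)) = stdProj τ D (r, x₀) := hk (r, x₀)
      rw [h₂, mk_stdProj τ D hρ, hs] at h₁
      exact h₁.symm
    subst hsr
    refine ⟨f, D.mem_B.mpr ⟨hf, fun x => ?_⟩, hs⟩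
    have h₂ : stdProj τ D (k (s, x)) = stdProj τ D (s, x) := hk (s, x)
    rw [hs] at h₂
    exact Subtype.ext ((τ.t s).injective h₂)
  · intro H
    have hk : ∀ c, stdProj τ D (k c) = stdProj τ D c := fun c => by
      obtain ⟨b, hb, hkb⟩ := H c.1
      have := hkb c.2
      rw [Prod.mk.eta] at this
      rw [this]
      change τ.t c.1 (D.σ (b c.2)) = τ.t c.1 (D.σ c.2)
      rw [(D.mem_B.mp hb).2]
    refine ⟨⟨⟨1, S.Aut.one_mem, hk⟩, fun r => ?_⟩, hk⟩
    obtain ⟨b, hb, hkb⟩ := H r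
    exact ⟨r, b, (D.mem_B.mp hb).1, hkb⟩

theorem prodShear_mem_kernel (hρ : S.IsCongruence ρ) {b : Quotient ρ → Equiv.Perm X}
    (hb : ∀ r, b r ∈ D.B) :
    Equiv.prodShear (Equiv.refl _) b ∈ (stdCover τ D hρ).kernel :=
  (mem_kernel_stdCover τ D hρ).mpr fun r => ⟨b r, hb r, fun _ => rfl⟩

theorem kernelIsFullProduct_stdCover (hρ : S.IsCongruence ρ) :
    (stdCover τ D hρ).KernelIsFullProduct ρ := by
  intro k hk
  have := fun r => (mem_kernel_stdCover τ D hρ).mp (hk r) r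
  choose b hb hkb using this
  refine ⟨_, prodShear_mem_kernel τ D hρ hb, fun c => ?_⟩
  change (c.1, b c.1 c.2) = k (Quotient.mk ρ (stdProj τ D c)) c
  rw [mk_stdProj τ D hρ, ← hkb]

theorem mem_above_cls_stdCover (hρ : S.IsCongruence ρ) (w : W) (c : Quotient ρ × X) :
    c ∈ (stdCover τ D hρ).above (cls ρ w) ↔ c.1 = Quotient.mk ρ w := by
  rw [← mk_stdProj τ D hρ c]
  exact Quotient.eq.symm

/-- The part of the standard cover above a class, identified with `X`. -/
def aboveClsEquiv (hρ : S.IsCongruence ρ) (w : W) : (stdCover τ D hρ).above (cls ρ w) ≃ X where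
  toFun c := c.1.2
  invFun x := ⟨(Quotient.mk ρ w, x), (mem_above_cls_stdCover τ D hρ w _).mpr rfl⟩
  left_inv c := Subtype.ext
    (Prod.ext ((mem_above_cls_stdCover τ D hρ w c).mp c.2).symm rfl)
  right_inv _ := rfl

theorem map_bindingGroup_cls_stdCover (hρ : S.IsCongruence ρ) (w : W) :
    ((stdCover τ D hρ).bindingGroup (cls ρ w)).map
      (aboveClsEquiv τ D hρ w).permCongrHom.toMonoidHom = D.B := by
  refine map_permCongrHom_eq _ ?_ fun b hb => ?_
  · rintro t ⟨k, hk, hkt⟩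
    obtain ⟨b, hb, hkb⟩ := (mem_kernel_stdCover τ D hρ).mp hk (Quotient.mk ρ w)
    refine ⟨b, hb, fun c => ?_⟩
    obtain ⟨x, rfl⟩ := (aboveClsEquiv τ D hρ w).symm.surjective c
    rw [Equiv.apply_symm_apply]
    change (t ((aboveClsEquiv τ D hρ w).symm x)).1.2 = _
    rw [← hkt]
    exact congrArg Prod.snd (hkb x)
  · exact ⟨_, ((stdCover τ D hρ).kernelRestrict _
      ⟨_, prodShear_mem_kernel τ D hρ fun _ => hb⟩).2, fun c => rfl⟩

/-- Above a single point `w` the binding group is `G`: the identification uses an element of `F`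
that moves the point of `[w₀]` corresponding to `w` to `w₀`. -/
theorem permIso_bindingGroup_stdCover (hS : S.IsTransitive) (hρ : S.IsCongruence ρ) (w : W) :
    PermIso ((stdCover τ D hρ).bindingGroup {w}) (D.G ⟨w₀, ρ.refl w₀⟩) := by
  obtain ⟨g, hg, hga⟩ := hS ((τ.t (Quotient.mk ρ w))⁻¹ w) w₀
  have hcls := τ.inv_apply_mem hρ w
  obtain ⟨f, hf, hfσ⟩ := D.exists_lift_mem
    (hρ.mem_setStab_cls hg hcls (by rw [hga]; exact ρ.refl w₀))
  have hmem : ∀ c : Quotient ρ × X, stdProj τ D c = w ↔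
      c.1 = Quotient.mk ρ w ∧ D.σ (f c.2) = ⟨w₀, ρ.refl w₀⟩ := fun c => by
    rw [Subtype.ext_iff, hfσ]
    constructor
    · rintro rfl
      have hc := mk_stdProj τ D hρ c
      refine ⟨hc.symm, ?_⟩
      rw [hc, stdProj, perm_inv_apply] at hga
      exact hga
    · rintro ⟨h₁, h₂⟩
      replace h₂ := g.injective (h₂.trans hga.symm)
      rw [← h₁] at h₂
      rw [stdProj, h₂, perm_apply_inv]
  let e : (stdCover τ D hρ).above {w} ≃ D.σ ⁻¹' {(⟨w₀, ρ.refl w₀⟩ : cls ρ w₀)} :=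
    { toFun := fun c => ⟨f c.1.2, ((hmem c.1).mp c.2).2⟩
      invFun := fun y => ⟨(Quotient.mk ρ w, f⁻¹ y), (hmem _).mpr
        ⟨rfl, by rw [perm_apply_inv]; exact y.2⟩⟩
      left_inv := fun c => Subtype.ext
        (Prod.ext ((hmem c.1).mp c.2).1.symm (perm_inv_apply f _))
      right_inv := fun y => Subtype.ext (perm_apply_inv f _) }
  refine ⟨e, map_permCongrHom_eq e ?_ ?_⟩
  · rintro t ⟨k, hk, hkt⟩
    obtain ⟨b, hb, hkb⟩ := (mem_kernel_stdCover τ D hρ).mp hk (Quotient.mk ρ w)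
    have hb' := D.conj_mem_B hf hb
    have hst : ∀ x, (f * b * f⁻¹) x ∈ D.σ ⁻¹' {(⟨w₀, ρ.refl w₀⟩ : cls ρ w₀)} ↔
        x ∈ D.σ ⁻¹' {(⟨w₀, ρ.refl w₀⟩ : cls ρ w₀)} := fun x => by
      rw [Set.mem_preimage, (D.mem_B.mp hb').2, Set.mem_preimage]
    refine ⟨(f * b * f⁻¹).subtypePerm hst, ⟨_, hb', fun _ => rfl⟩, fun c => Subtype.ext ?_⟩
    have hc : (c : Quotient ρ × X) = (Quotient.mk ρ w, c.1.2) :=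
      Prod.ext ((hmem c.1).mp c.2).1 rfl
    have h₁ : (t c : Quotient ρ × X) = (Quotient.mk ρ w, b c.1.2) := by
      rw [← hkt, hc, hkb]
    change f (t c).1.2 = f (b (f⁻¹ (f c.1.2)))
    rw [h₁, perm_inv_apply]
  · rintro q ⟨b, hb, hbq⟩
    have hb' := D.conj_mem_B (D.F.inv_mem hf) hb
    refine ⟨_, ((stdCover τ D hρ).kernelRestrict {w}
      ⟨_, prodShear_mem_kernel τ D hρ fun _ => hb'⟩).2, fun c => Subtype.ext ?_⟩
    rw [← hbq]
    change f (f⁻¹ (b (f⁻¹⁻¹ c.1.2))) = b (f c.1.2)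
    rw [perm_apply_inv, inv_inv]

theorem isAlmostFree_stdCover (hS : S.IsTransitive) (hρ : S.IsCongruence ρ)
    (hB : Nonempty (D.B ≃* D.G ⟨w₀, ρ.refl w₀⟩)) :
    (stdCover τ D hρ).IsAlmostFree ρ (D.G ⟨w₀, ρ.refl w₀⟩) where
  binding w := (permIso_bindingGroup_stdCover τ D hS hρ w).nonempty_mulEquiv
  same_class w := by
    obtain ⟨e⟩ := hB
    obtain ⟨e'⟩ := PermIso.nonempty_mulEquiv ⟨_, map_bindingGroup_cls_stdCover τ D hρ w⟩
    exact ⟨e'.trans e⟩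
  distinct_classes a b hab := by
    obtain ⟨ea⟩ := (permIso_bindingGroup_stdCover τ D hS hρ a).nonempty_mulEquiv
    obtain ⟨eb⟩ := (permIso_bindingGroup_stdCover τ D hS hρ b).nonempty_mulEquiv
    obtain ⟨e⟩ := (kernelIsFullProduct_stdCover τ D hρ).nonempty_mulEquiv hab
    exact ⟨e.trans (ea.prodCongr eb)⟩

theorem isDataOf_stdCover (hρ : S.IsCongruence ρ) : D.IsDataOf (stdCover τ D hρ) := by
  have hproj : ∀ x, stdProj τ D (Quotient.mk ρ w₀, x) = D.σ x := fun x => by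
    rw [stdProj, τ.base]
    rfl
  refine D.isDataOf_of_map_eq (aboveClsEquiv τ D hρ w₀) (fun c => ?_) ?_
    (map_bindingGroup_cls_stdCover τ D hρ w₀)
  · obtain ⟨x, rfl⟩ := (aboveClsEquiv τ D hρ w₀).symm.surjective c
    rw [Equiv.apply_symm_apply]
    exact (hproj x).symm
  · refine map_permCongrHom_eq _ ?_ fun f hf => ?_
    · rintro t ⟨h, ⟨⟨-, H⟩, -⟩, hht⟩
      obtain ⟨s, f, hf, hs⟩ := H (Quotient.mk ρ w₀)
      refine ⟨f, hf, fun c => ?_⟩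
      obtain ⟨x, rfl⟩ := (aboveClsEquiv τ D hρ w₀).symm.surjective c
      rw [Equiv.apply_symm_apply]
      change (t ((aboveClsEquiv τ D hρ w₀).symm x)).1.2 = _
      rw [← hht]
      exact congrArg Prod.snd (hs x)
    -- lift the permutation of `[w₀]` under `f` to the cover, and correct the lift `h` by the kernel
    -- element that acts as `f'⁻¹ * f ∈ B` on every class, where `f'` is the action of `h` on the
    -- copy of `X` above `[w₀]`
    · have hT : D.T ⟨f, hf⟩ ∈ inducedOn (setStab S.Aut (cls ρ w₀)) (cls ρ w₀) :=
        D.range_eq ▸ ⟨⟨f, hf⟩, rfl⟩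
      obtain ⟨g, hg, hgT⟩ := hT
      have hgσ : ∀ x, g (D.σ x) = D.σ (f x) := fun x => by
        rw [hgT]
        exact congrArg Subtype.val (inducedHom_apply _ _ _ D.invariant ⟨f, hf⟩ x)
      obtain ⟨h, hh, hhg⟩ := exists_stdAut_above τ D hρ hg.1
      obtain ⟨s, f', hf', hs⟩ := hh.2 (Quotient.mk ρ w₀)
      have hs₀ : ∀ x, s = Quotient.mk ρ w₀ ∧ D.σ (f' x) = D.σ (f x) := fun x => by
        have h₁ := hhg (Quotient.mk ρ w₀, x)
        rw [hs, hproj, hgσ] at h₁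
        have h₂ := mk_stdProj τ D hρ (s, f' x)
        rw [h₁] at h₂
        have h₃ : s = Quotient.mk ρ w₀ := h₂.symm.trans (Quotient.sound (D.σ (f x)).2)
        rw [h₃, hproj] at h₁
        exact ⟨h₃, Subtype.ext h₁⟩
      obtain ⟨x₀, -⟩ := D.surjective ⟨w₀, ρ.refl w₀⟩
      have hb : f'⁻¹ * f ∈ D.B := by
        refine D.mem_B.mpr ⟨D.F.mul_mem (D.F.inv_mem hf') hf, fun x => ?_⟩
        refine (D.invariant _ (D.F.inv_mem hf') _ _ (hs₀ x).2.symm).trans ?_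
        rw [perm_inv_apply]
      have hk := prodShear_mem_kernel τ D hρ fun _ => hb
      let h' := h * Equiv.prodShear (Equiv.refl _) fun _ => f'⁻¹ * f
      have hh' : h' ∈ stdAut τ D :=
        (stdAut τ D).mul_mem hh ((FiniteCover.mem_kernel _).mp hk).1
      have hval : ∀ x, h' (Quotient.mk ρ w₀, x) = (Quotient.mk ρ w₀, f x) := fun x => by
        change h (Quotient.mk ρ w₀, f'⁻¹ (f x)) = _
        rw [hs, perm_apply_inv, (hs₀ x₀).1]
      have hst : ∀ c, h' c ∈ (stdCover τ D hρ).above (cls ρ w₀) ↔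
          c ∈ (stdCover τ D hρ).above (cls ρ w₀) := fun c => by
        change stdProj τ D (h (Equiv.prodShear (Equiv.refl _) (fun _ => f'⁻¹ * f) c)) ∈ cls ρ w₀ ↔
          stdProj τ D c ∈ cls ρ w₀
        rw [hhg, hg.2]
        exact iff_of_eq (congrArg (· ∈ cls ρ w₀) (((FiniteCover.mem_kernel _).mp hk).2 c))
      refine ⟨h'.subtypePerm hst, ⟨h', ⟨hh', hst⟩, fun _ => rfl⟩, fun c => ?_⟩
      obtain ⟨x, rfl⟩ := (aboveClsEquiv τ D hρ w₀).symm.surjective c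
      rw [Equiv.apply_symm_apply]
      exact congrArg Prod.snd (hval x)

end Standard

section Uniqueness

/-! ### Uniqueness -/

variable {W : Type u} {S : PermStructure W} {ρ : Setoid W} {w₀ : W} (τ : Transversal S ρ w₀)
  {X : Type v} (D : ClassData S (cls ρ w₀) X)

/-- A cover with data `D` whose kernel is the full product is the standard cover: lifts `h r` of the
transversal to the cover identify the part above the class `r` with the part above the class of
`w₀`, that is, with `X`. In these coordinates every automorphism of the cover lies in `stdAut`, and
every element of the kernel `B ^ (W/ρ)` of the standard cover occurs. -/
theorem isoOver_stdCover (hρ : S.IsCongruence ρ) {C : Type w} {π : FiniteCover S C}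
    (hD : D.IsDataOf π) (hfull : π.KernelIsFullProduct ρ) : π.IsoOver (stdCover τ D hρ) := by
  obtain ⟨γ, hσ, hF, hB, -⟩ := hD
  obtain ⟨hF, -⟩ := exists_of_map_permCongrHom_eq hF
  obtain ⟨-, hB⟩ := exists_of_map_permCongrHom_eq hB
  choose h hh hproj using fun r => π.exists_above (τ.mem r)
  let p : C → Quotient ρ := fun c => Quotient.mk ρ (π.proj c)
  have hp : ∀ r (c : π.above (cls ρ w₀)), p (h r c) = r := fun r c => by
    change Quotient.mk ρ (π.proj (h r c)) = r
    rw [hproj]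
    exact τ.apply_class hρ c.2
  have hmem : ∀ c, (h (p c))⁻¹ c ∈ π.above (cls ρ w₀) := fun c => by
    have := hproj (p c) ((h (p c))⁻¹ c)
    rw [perm_apply_inv] at this
    change π.proj ((h (p c))⁻¹ c) ∈ cls ρ w₀
    rw [← perm_inv_apply (τ.t (p c)) (π.proj _), ← this]
    exact τ.inv_apply_mem hρ _
  let α : C ≃ Quotient ρ × X :=
    { toFun := fun c => (p c, γ ⟨(h (p c))⁻¹ c, hmem c⟩)
      invFun := fun y => h y.1 (γ.symm y.2)
      left_inv := fun c => by
        change h (p c) (γ.symm (γ _)) = c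
        rw [γ.symm_apply_apply, perm_apply_inv]
      right_inv := fun y => by
        have hy := hp y.1 (γ.symm y.2)
        refine Prod.ext hy ?_
        change γ ⟨_, _⟩ = y.2
        rw [← γ.eq_symm_apply]
        refine Subtype.ext ?_
        change (h (p (h y.1 (γ.symm y.2))))⁻¹ (h y.1 (γ.symm y.2)) = _
        rw [hy, perm_inv_apply] }
  have hα : ∀ r (c : π.above (cls ρ w₀)), α (h r c) = (r, γ c) := fun r c => by
    rw [← α.eq_symm_apply]
    change h r c = h r (γ.symm (γ c))
    rw [γ.symm_apply_apply]
  have hαsymm : ∀ c, ∃ r, ∃ d : π.above (cls ρ w₀), c = h r d := fun c =>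
    ⟨p c, ⟨_, hmem c⟩, (perm_apply_inv _ _).symm⟩
  have hαproj : ∀ c, stdProj τ D (α c) = π.proj c := fun c => by
    obtain ⟨r, d, rfl⟩ := hαsymm c
    rw [hα, stdProj, hσ, hproj]
  -- automorphisms of `π` lie in `stdAut`
  have hsub : ∀ g ∈ π.Aut, ∃ q ∈ stdAut τ D, ∀ c, α (g c) = q (α c) := by
    intro g hg
    obtain ⟨m, hm, hgm⟩ := π.exists_base hg
    refine ⟨α.permCongrHom g, ⟨⟨m, hm, fun y => ?_⟩, fun r => ?_⟩, fun c => ?_⟩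
    · obtain ⟨c, rfl⟩ := α.surjective y
      change stdProj τ D (α (g (α.symm (α c)))) = _
      rw [α.symm_apply_apply, hαproj, hαproj, hgm]
    · let s := Quotient.mk ρ (m (τ.t r w₀))
      have hst := τ.conj_mem_setStab hρ hm (r := r) (s := s) rfl
      have hproj' : ∀ c, π.proj ((h s)⁻¹ c) = (τ.t s)⁻¹ (π.proj c) := fun c => by
        rw [Equiv.Perm.eq_inv_iff_eq, ← hproj, perm_apply_inv]
      have hk : (h s)⁻¹ * g * h r ∈ setStab π.Aut (π.above (cls ρ w₀)) := by
        refine ⟨π.Aut.mul_mem (π.Aut.mul_mem (π.Aut.inv_mem (hh s)) hg) (hh r), fun c => ?_⟩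
        change π.proj ((h s)⁻¹ (g (h r c))) ∈ cls ρ w₀ ↔ π.proj c ∈ cls ρ w₀
        rw [hproj', hgm, hproj]
        exact hst.2 _
      obtain ⟨f, hf, hfγ⟩ := hF (((h s)⁻¹ * g * h r).subtypePerm hk.2) ⟨_, hk, fun _ => rfl⟩
      refine ⟨s, f, hf, fun x => ?_⟩
      obtain ⟨c, rfl⟩ := γ.surjective x
      rw [← hfγ, ← hα, ← hα]
      change α (g (α.symm (α _))) = α (h s ((h s)⁻¹ (g (h r c))))
      rw [α.symm_apply_apply, perm_apply_inv]
    · change _ = α (g (α.symm (α c)))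
      rw [α.symm_apply_apply]
  refine ⟨α, hαproj, map_permCongrHom_eq α hsub fun q hq => ?_⟩
  -- conversely, divide `q` by an automorphism of `π` with the same action on `W`
  obtain ⟨m, hm, hqm⟩ := hq.1
  obtain ⟨g, hg, hgm⟩ := π.exists_above hm
  obtain ⟨q', hq', hgq'⟩ := hsub g hg
  have hker : q'⁻¹ * q ∈ (stdCover τ D hρ).kernel := by
    refine (FiniteCover.mem_kernel _).mpr
      ⟨(stdAut τ D).mul_mem ((stdAut τ D).inv_mem hq') hq, fun y => ?_⟩
    have hq'm : ∀ y, stdProj τ D (q' y) = m (stdProj τ D y) := fun y => by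
      obtain ⟨c, rfl⟩ := α.surjective y
      rw [← hgq', hαproj, hαproj, hgm]
    change stdProj τ D (q'⁻¹ (q y)) = stdProj τ D y
    rw [← m.injective.eq_iff, ← hq'm, perm_apply_inv, hqm]
  choose b hb hqb using (mem_kernel_stdCover τ D hρ).mp hker
  have hlift : ∀ r, ∃ k ∈ π.kernel, ∀ c : π.above (cls ρ w₀), ∃ d : π.above (cls ρ w₀),
      k c = d ∧ γ d = b r (γ c) := fun r => by
    obtain ⟨t, ⟨k, hk, hkt⟩, htb⟩ := hB (b r) (hb r)
    exact ⟨k, hk, fun c => ⟨t c, hkt c, htb c⟩⟩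
  choose k hk hkb using hlift
  obtain ⟨κ, hκ, hκc⟩ := hfull _ fun r => π.conj_mem_kernel (hh r) (hk r)
  refine ⟨g * κ, π.Aut.mul_mem hg (π.mem_kernel.mp hκ).1, fun c => ?_⟩
  obtain ⟨r, d, rfl⟩ := hαsymm c
  obtain ⟨d', hd', hγd'⟩ := hkb r d
  have h₁ : κ (h r d) = h r d' := by
    rw [hκc]
    change h (p (h r d)) (k (p (h r d)) ((h (p (h r d)))⁻¹ (h r d))) = _
    rw [hp, perm_inv_apply, hd']
  change α (g (κ (h r d))) = _
  rw [hgq', h₁, hα, hγd', ← hqb, ← hα]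
  exact perm_apply_inv q' _

end Uniqueness

end FinCov

theorem mainTheorem3 {W : Type u} (S : PermStructure W) (hW : S.IsTransitive)
    (ρ : Setoid W) (hρ : S.IsCongruence ρ)
    (hM_inj : Function.Injective (classHom hρ))
    (hM_open : IsOpenMap (classHom hρ).rangeRestrict)
    (hM_closed : IsClosed ((classHom hρ).range : Set (Equiv.Perm (Quotient ρ))))
    (w₀ : W) {X : Type v} (D : ClassData S (cls ρ w₀) X)
    (hχ : Continuous D.chi)
    (hB : Nonempty (D.B ≃* D.G ⟨w₀, ρ.refl w₀⟩)) :
    ∃ (C₀ : Type (max u v)) (π₀ : FiniteCover S C₀),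
      π₀.IsAlmostFree ρ (D.G ⟨w₀, ρ.refl w₀⟩) ∧
      (∀ w, PermIso (π₀.bindingGroup {w}) (D.G ⟨w₀, ρ.refl w₀⟩)) ∧
      π₀.KernelIsFullProduct ρ ∧
      D.IsDataOf π₀ ∧
      ∀ (C : Type w) (π : FiniteCover S C),
        π.IsAlmostFree ρ (D.G ⟨w₀, ρ.refl w₀⟩) →
        D.IsDataOf π →
        (π.KernelIsFullProduct ρ ∨ Group.IsPerfect (D.G ⟨w₀, ρ.refl w₀⟩)) →
        π.IsoOver π₀ := by
  obtain ⟨τ⟩ := hW.nonempty_transversal ρ w₀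
  refine ⟨Quotient ρ × X, stdCover τ D hρ, isAlmostFree_stdCover τ D hW hρ hB,
    permIso_bindingGroup_stdCover τ D hW hρ, kernelIsFullProduct_stdCover τ D hρ,
    isDataOf_stdCover τ D hρ, fun C π hfree hD hor => ?_⟩
  refine isoOver_stdCover τ D hρ hD (hor.elim id fun _ => ?_)
  have : Finite (D.σ ⁻¹' {(⟨w₀, ρ.refl w₀⟩ : cls ρ w₀)}) := (D.finite_fibre _).to_subtype
  exact hfree.kernelIsFullProduct_of_isPerfect
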